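/- All rings are commutative with nonzero identity, and all ring extensions and algebra homomorphisms are unital. A ring $R$ is von Neumann regular if for every $a\in R$ there is $x\in R$ with $a=axa$. For an $R$-module $E$, the idealization $R(+)E$ is the ring with additive group $R\oplus E$ and multiplication $(r_1,e_1)(r_2,e_2)=(r_1r_2,\,r_1e_2+r_2e_1)$, regarded as an $R$-algebra via $r\mapsto(r,0)$. A ring extension $R\subset T$ is minimal if $R$ is a proper subring of $T$ and there is no ring $S$ with $R\subsetneq S\subsetneq T$. **Theorem.** Let $R\subset T$ be a minimal ring extension with $R$ von Neumann regular. Then either $T$ is von Neumann regular, or there is a maximal ideal $\mathfrak m$ of $R$ such that $T\cong R(+)R/\mathfrak m$ as $R$-algebras. -/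

import Mathlib

/-- A commutative ring `R` is von Neumann regular if every `a : R` has a quasi-inverse `x`,
that is, `a = a * x * a`. -/
def IsVonNeumannRegular (R : Type*) [CommRing R] : Prop :=
  ∀ a : R, ∃ x : R, a * x * a = a

/-- `R ⊂ T` is a minimal ring extension: the structure map `R → T` is injective, and its image is
a proper subring of `T` such that no subring of `T` lies strictly between the two. -/
structure IsMinimalRingExtension (R T : Type*) [CommRing R] [CommRing T] [Algebra R T] : Prop where
  injective : Function.Injective (algebraMap R T)
  range_ne_top : (algebraMap R T).range ≠ ⊤
  no_intermediate : ¬ ∃ S : Subring T, (algebraMap R T).range < S ∧ S < ⊤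

/-!
Suppose first that `T` is reduced and let `t : T`. By minimality, either `t ^ 2 ∈ R` or
`R[t ^ 2] = T`. In the first case `t ^ 4 ∣ t ^ 2`, and reducedness cancels a square. In the second,
`t = c + t ^ 2 * q` with `c ∈ R`, so `t ∣ c`, hence `t ^ 2 ∣ c ^ 2 ∣ c` and `t ^ 2 ∣ t`.

Now let `x ≠ 0` satisfy `x ^ 2 = 0`. As `R` is reduced, `x ∉ R`, so `T = R[x] = R ⊕ Rx`. The same
holds for every nonzero multiple `y` of `x`. So `Ry ⊆ Rx` are both complements of `R`, which forces
`Ry = Rx`: the module `Rx` is simple, that is, isomorphic to `R ⧸ m` with `m = ann x` maximal.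
-/

section

variable {R A : Type*} [CommSemiring R] [Semiring A] [Algebra R A]

theorem exists_eq_algebraMap_add_mul_of_mem_adjoin_singleton {t y : A}
    (hy : y ∈ Algebra.adjoin R {t}) :
    ∃ c : R, ∃ q ∈ Algebra.adjoin R {t}, y = algebraMap R A c + t * q := by
  rw [Algebra.adjoin_singleton_eq_range_aeval] at hy ⊢
  obtain ⟨p, rfl⟩ := hy
  refine ⟨p.coeff 0, _, ⟨p.divX, rfl⟩, ?_⟩
  calc
    Polynomial.aeval t p = Polynomial.aeval t (Polynomial.C (p.coeff 0) + Polynomial.X * p.divX) :=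
      by rw [add_comm, p.X_mul_divX_add]
    _ = algebraMap R A (p.coeff 0) + t * Polynomial.aeval t p.divX := by
      rw [map_add, map_mul, Polynomial.aeval_C, Polynomial.aeval_X]

open Submodule

variable {x : A}

theorem mul_eq_zero_of_mem_span_singleton (hx : x ^ 2 = 0) {u v : A} (hu : u ∈ R ∙ x)
    (hv : v ∈ R ∙ x) : u * v = 0 := by
  obtain ⟨a, rfl⟩ := mem_span_singleton.1 hu
  obtain ⟨b, rfl⟩ := mem_span_singleton.1 hv
  rw [smul_mul_smul_comm, ← sq, hx, smul_zero]

theorem disjoint_one_span_singleton_of_isNilpotent [IsReduced R]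
    (hinj : Function.Injective (algebraMap R A)) (hx : IsNilpotent x) :
    Disjoint (1 : Submodule R A) (R ∙ x) := by
  rw [disjoint_def]
  rintro _ hr hrx
  obtain ⟨r, rfl⟩ := mem_one.1 hr
  obtain ⟨a, ha⟩ := mem_span_singleton.1 hrx
  have hnil : IsNilpotent (algebraMap R A r) := ha ▸ hx.smul a
  rw [((IsNilpotent.map_iff hinj).1 hnil).eq_zero, map_zero]

theorem toSubmodule_adjoin_singleton_of_sq_eq_zero (hx : x ^ 2 = 0) :
    Subalgebra.toSubmodule (Algebra.adjoin R {x}) = 1 ⊔ R ∙ x := by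
  refine le_antisymm (fun y hy => ?_) (sup_le ?_ ?_)
  · obtain ⟨r, q, hq, rfl⟩ := exists_eq_algebraMap_add_mul_of_mem_adjoin_singleton hy
    obtain ⟨s, q', -, rfl⟩ := exists_eq_algebraMap_add_mul_of_mem_adjoin_singleton hq
    have hsx : x * (algebraMap R A s + x * q') = s • x := by
      rw [mul_add, ← mul_assoc, ← sq, hx, zero_mul, add_zero, Algebra.smul_def, Algebra.commutes]
    exact add_mem_sup (algebraMap_mem r) (hsx ▸ smul_mem _ s (mem_span_singleton_self x))
  · exact Algebra.toSubmodule_bot (R := R) (A := A) ▸ Subalgebra.toSubmodule.monotone bot_le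
  · exact (span_singleton_le_iff_mem _ _).2 (Algebra.self_mem_adjoin_singleton R x)

end

open Submodule in
/-- The isomorphism from the idealization `R(+)M` onto an `R`-algebra `A` that is the internal
direct sum of `R` and a square-zero copy of `M`, embedded by `g`. -/
noncomputable def trivSqZeroExtEquivOfIsCompl {R A M : Type*} [CommRing R] [Ring A] [Algebra R A]
    [AddCommGroup M] [Module R M] [Module Rᵐᵒᵖ M] [IsCentralScalar R M]
    (hinj : Function.Injective (algebraMap R A))
    (g : M →ₗ[R] A) (hg : Function.Injective g) (hmul : ∀ u v, g u * g v = 0)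
    (hcompl : IsCompl (1 : Submodule R A) (LinearMap.range g)) : TrivSqZeroExt R M ≃ₐ[R] A :=
  AlgEquiv.ofBijective (TrivSqZeroExt.liftEquivOfComm ⟨g, hmul⟩) <| by
    rw [one_eq_range] at hcompl
    change Function.Bijective ((Algebra.linearMap R A).coprod g)
    constructor
    · rw [← LinearMap.ker_eq_bot, LinearMap.ker_coprod_of_disjoint_range _ _ hcompl.disjoint,
        LinearMap.ker_eq_bot.2 hg, LinearMap.ker_eq_bot.2 hinj, prod_bot]
    · rw [← LinearMap.range_eq_top, LinearMap.range_coprod, hcompl.sup_eq_top]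

section

variable {R T : Type*} [CommRing R] [CommRing T] [Algebra R T]

namespace IsVonNeumannRegular

theorem iff_sq_dvd_self : IsVonNeumannRegular R ↔ ∀ a : R, a ^ 2 ∣ a :=
  forall_congr' fun _ => exists_congr fun _ => by rw [eq_comm, mul_right_comm, sq]

theorem algebraMap_sq_dvd_self (hR : IsVonNeumannRegular R) (a : R) :
    algebraMap R T a ^ 2 ∣ algebraMap R T a := by
  simpa only [map_pow] using map_dvd (algebraMap R T) (iff_sq_dvd_self.1 hR a)

theorem isReduced (hR : IsVonNeumannRegular R) : IsReduced R :=
  (isReduced_iff_pow_one_lt 2 one_lt_two).2 fun a ha =>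
    zero_dvd_iff.1 (ha ▸ iff_sq_dvd_self.1 hR a)

theorem sq_dvd_self_of_sq_mem_bot [IsReduced T] (hR : IsVonNeumannRegular R) {t : T}
    (ht : t ^ 2 ∈ (⊥ : Subalgebra R T)) : t ^ 2 ∣ t := by
  obtain ⟨a, ha⟩ := Algebra.mem_bot.1 ht
  obtain ⟨x, hx⟩ : (t ^ 2) ^ 2 ∣ t ^ 2 := ha ▸ hR.algebraMap_sq_dvd_self a
  have hsq : (t - t ^ 3 * x) ^ 2 = 0 := by linear_combination (1 - t ^ 2 * x) * hx
  exact ⟨t * x, by linear_combination eq_zero_of_pow_eq_zero hsq⟩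

theorem sq_dvd_self_of_mem_adjoin_sq (hR : IsVonNeumannRegular R) {t : T}
    (ht : t ∈ Algebra.adjoin R {t ^ 2}) : t ^ 2 ∣ t := by
  obtain ⟨c, q, -, hq⟩ := exists_eq_algebraMap_add_mul_of_mem_adjoin_singleton ht
  have htc : t ∣ algebraMap R T c := ⟨1 - t * q, by linear_combination -hq⟩
  have htc' : t ^ 2 ∣ algebraMap R T c :=
    (pow_dvd_pow_of_dvd htc 2).trans (hR.algebraMap_sq_dvd_self c)
  simpa only [← hq] using htc'.add (dvd_mul_right (t ^ 2) q)

end IsVonNeumannRegular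

namespace IsMinimalRingExtension

open Submodule

theorem subalgebra_eq_bot_or_eq_top (h : IsMinimalRingExtension R T) (A : Subalgebra R T) :
    A = ⊥ ∨ A = ⊤ := by
  by_contra! hA
  refine h.no_intermediate ⟨A.toSubring, ?_, ?_⟩
  · simpa [← SetLike.coe_ssubset_coe] using bot_lt_iff_ne_bot.2 hA.1
  · simpa [← SetLike.coe_ssubset_coe] using lt_top_iff_ne_top.2 hA.2

theorem adjoin_singleton_eq_top (h : IsMinimalRingExtension R T) {t : T}
    (ht : t ∉ (⊥ : Subalgebra R T)) : Algebra.adjoin R {t} = ⊤ :=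
  (h.subalgebra_eq_bot_or_eq_top _).resolve_left fun hbot =>
    ht (hbot ▸ Algebra.self_mem_adjoin_singleton R t)

theorem isVonNeumannRegular [IsReduced T] (h : IsMinimalRingExtension R T)
    (hR : IsVonNeumannRegular R) : IsVonNeumannRegular T := by
  refine IsVonNeumannRegular.iff_sq_dvd_self.2 fun t => ?_
  by_cases ht : t ^ 2 ∈ (⊥ : Subalgebra R T)
  · exact hR.sq_dvd_self_of_sq_mem_bot ht
  · exact hR.sq_dvd_self_of_mem_adjoin_sq (h.adjoin_singleton_eq_top ht ▸ Algebra.mem_top)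

variable [IsReduced R] {x : T}

theorem isCompl_one_span_singleton (h : IsMinimalRingExtension R T) (hx : x ^ 2 = 0)
    (hx0 : x ≠ 0) : IsCompl (1 : Submodule R T) (R ∙ x) := by
  have hdisj : Disjoint (1 : Submodule R T) (R ∙ x) :=
    disjoint_one_span_singleton_of_isNilpotent h.injective ⟨2, hx⟩
  have hmem : x ∉ (⊥ : Subalgebra R T) := fun hbot =>
    hx0 (disjoint_def.1 hdisj x (mem_one.2 (Algebra.mem_bot.1 hbot)) (mem_span_singleton_self x))
  refine ⟨hdisj, codisjoint_iff.2 ?_⟩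
  rw [← toSubmodule_adjoin_singleton_of_sq_eq_zero hx, h.adjoin_singleton_eq_top hmem,
    Algebra.top_toSubmodule]

theorem isAtom_span_singleton (h : IsMinimalRingExtension R T) (hx : x ^ 2 = 0) (hx0 : x ≠ 0) :
    IsAtom (R ∙ x) := by
  refine isAtom_iff_le_of_ge.2 ⟨by simpa using hx0, fun N hN hNx => ?_⟩
  obtain ⟨y, hyN, hy0⟩ := N.ne_bot_iff.1 hN
  have hy : y ^ 2 = 0 := sq y ▸ mul_eq_zero_of_mem_span_singleton hx (hNx hyN) (hNx hyN)
  have hyx : R ∙ y ≤ R ∙ x := (span_singleton_le_iff_mem _ _).2 (hNx hyN)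
  have hcomplx := h.isCompl_one_span_singleton hx hx0
  have hcomply := h.isCompl_one_span_singleton hy hy0
  have heq : R ∙ y = R ∙ x := eq_of_le_of_inf_le_of_sup_le (z := 1) hyx
    (hcomplx.symm.inf_eq_bot.trans_le bot_le) (le_top.trans_eq hcomply.symm.sup_eq_top.symm)
  exact heq ▸ (span_singleton_le_iff_mem _ _).2 hyN

theorem isMaximal_torsionOf (h : IsMinimalRingExtension R T) (hx : x ^ 2 = 0) (hx0 : x ≠ 0) :
    (Ideal.torsionOf R T x).IsMaximal := by
  rw [Ideal.isMaximal_def, ← isSimpleModule_iff_isCoatom,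
    (Ideal.quotTorsionOfEquivSpanSingleton R T x).isSimpleModule_iff, isSimpleModule_iff_isAtom]
  exact h.isAtom_span_singleton hx hx0

/-- The isomorphism of a minimal extension of a reduced ring containing a nonzero square-zero `x`
with an idealization; the annihilator of `x` is written `Ideal.torsionOf R T x`. -/
noncomputable def algEquivTrivSqZeroExt (h : IsMinimalRingExtension R T) (hx : x ^ 2 = 0)
    (hx0 : x ≠ 0) : T ≃ₐ[R] TrivSqZeroExt R (R ⧸ Ideal.torsionOf R T x) :=
  let e := Ideal.quotTorsionOfEquivSpanSingleton R T x
  (trivSqZeroExtEquivOfIsCompl h.injective ((R ∙ x).subtype ∘ₗ e.toLinearMap)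
    (Subtype.val_injective.comp e.injective)
    (fun u v => mul_eq_zero_of_mem_span_singleton hx (e u).2 (e v).2)
    (by simpa [LinearMap.range_comp] using h.isCompl_one_span_singleton hx hx0)).symm

theorem exists_algEquiv_trivSqZeroExt (h : IsMinimalRingExtension R T) (hT : ¬IsReduced T) :
    ∃ m : Ideal R, m.IsMaximal ∧ Nonempty (T ≃ₐ[R] TrivSqZeroExt R (R ⧸ m)) := by
  rw [isReduced_iff_pow_one_lt 2 one_lt_two] at hT
  push Not at hT
  obtain ⟨x, hx, hx0⟩ := hT
  exact ⟨_, h.isMaximal_torsionOf hx hx0, ⟨h.algEquivTrivSqZeroExt hx hx0⟩⟩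

end IsMinimalRingExtension

end

theorem theorem2p1 {R T : Type*} [CommRing R] [CommRing T] [Algebra R T]
    (hRT : IsMinimalRingExtension R T) (hR : IsVonNeumannRegular R) :
    IsVonNeumannRegular T ∨
      ∃ m : Ideal R, m.IsMaximal ∧ Nonempty (T ≃ₐ[R] TrivSqZeroExt R (R ⧸ m)) := by
  by_cases hT : IsReduced T
  · exact Or.inl (hRT.isVonNeumannRegular hR)
  · have := hR.isReduced
    exact Or.inr (hRT.exists_algEquiv_trivSqZeroExt hT)
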